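/- Let $q$ be a prime power and $t\ge 1$ an integer. The dot-product graph on $\mathbb{F}_q^t$ has vertex set $V=\mathbb{F}_q^t\setminus\{0\}$, and $x\sim y$ if and only if $x\cdot y=x_1y_1+\cdots+x_ty_t=1$ (so a vertex $x$ with $x\cdot x=1$ is adjacent to itself). For $U\subseteq V$ and $v\in U$ let $h_v\colon U\to\{0,1\}$ be the function with $h_v(u)=1$ if $u\sim v$ and $h_v(u)=0$ otherwise, and let $\mathcal{H}(U)=\{h_v : v\in U\}$. A family $\mathcal{H}$ of functions $U\to\{0,1\}$ shatters $X\subseteq U$ if the restrictions to $X$ of the members of $\mathcal{H}$ are all the functions $X\to\{0,1\}$; the VC-dimension of $\mathcal{H}$ is the largest size of a set that it shatters. **Theorem.** There is an absolute constant $C>0$ such that for every prime power $q$, every integer $t\ge 1$ and every set $U\subseteq\mathbb{F}_q^t\setminus\{0\}$ of vertices of the dot-product graph: 1. if $|U|\ge C\,q^{\frac{t+1}{2}}$, then the VC-dimension of $\mathcal{H}(U)$ is at least $2$; 2. if $|U|\ge C\max\{q^{\frac{7t+19}{14}},\,q^{t-1}\}$, then the VC-dimension of $\mathcal{H}(U)$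 is at least $3$. -/

import Mathlib

/-- The vertex set `F^t \ {0}` of the dot-product graph. -/
abbrev DotVertex (F : Type*) [Field F] (t : ℕ) : Type _ :=
  {x : Fin t → F // x ≠ 0}

/-- Adjacency in the dot-product graph: `x ∼ y` iff `x₁ y₁ + ⋯ + x_t y_t = 1`.
A vertex with `x · x = 1` is adjacent to itself (the graph may have loops). -/
def DotAdj {F : Type*} [Field F] {t : ℕ} (x y : DotVertex F t) : Prop :=
  ∑ i, x.1 i * y.1 i = 1

open Classical in
/-- The function `h_v : U → {0, 1}`, `h_v u = 1` iff `u ∼ v`. -/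
noncomputable def adjFun {V : Type*} (Adj : V → V → Prop) (U : Finset V) (v : U) : U → Fin 2 :=
  fun u => if Adj u v then 1 else 0

open Classical in
/-- The family `H(U) = {h_v : v ∈ U}` of functions `U → {0, 1}`. -/
noncomputable def adjFamily {V : Type*} (Adj : V → V → Prop) (U : Finset V) :
    Finset (U → Fin 2) :=
  Finset.univ.image (adjFun Adj U)

open Classical in
/-- The VC-dimension of a family of functions `W → {0, 1}` on a finite set `W`: the
VC-dimension of the corresponding family of subsets `{w | h w = 1}` of `W`. -/
noncomputable def functionVCDim {W : Type*} [Fintype W] (H : Finset (W → Fin 2)) : ℕ :=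
  (H.image fun h => Finset.univ.filter fun w => h w = 1).vcDim

/-- The definition above agrees with the one through restrictions of functions: the dimension is
at least `d` iff some `X` of size `d` is such that the restrictions to `X` of the members of `H`
are all the functions `X → {0, 1}` (here `H` is non-empty, as no set is shattered otherwise). -/
theorem le_functionVCDim_iff {W : Type*} [Fintype W] (H : Finset (W → Fin 2))
    (hH : H.Nonempty) (d : ℕ) :
    d ≤ functionVCDim H ↔
      ∃ X : Finset W, X.card = d ∧ ∀ g : X → Fin 2, ∃ h ∈ H, ∀ x : X, h x = g x := by
  classical
  have key : ∀ X : Finset W,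
      (H.image fun h => Finset.univ.filter fun w => h w = 1).Shatters X ↔
        ∀ g : X → Fin 2, ∃ h ∈ H, ∀ x : X, h x = g x := by
    intro X
    have two : ∀ a b : Fin 2, (a = 1 ↔ b = 1) → a = b := by decide
    constructor
    · intro hX g
      obtain ⟨u, hu, hXu⟩ := hX (t := X.filter fun w => ∃ hw : w ∈ X, g ⟨w, hw⟩ = 1)
        (Finset.filter_subset _ _)
      obtain ⟨h, hh, rfl⟩ := Finset.mem_image.1 hu
      refine ⟨h, hh, fun x => two _ _ ?_⟩
      have := Finset.ext_iff.1 hXu x.1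
      simpa [x.2] using this
    · intro hX s hs
      obtain ⟨h, hh, hg⟩ := hX fun x => if x.1 ∈ s then 1 else 0
      refine ⟨_, Finset.mem_image_of_mem _ hh, ?_⟩
      ext w
      by_cases hw : w ∈ X
      · have := hg ⟨w, hw⟩
        by_cases hws : w ∈ s <;> simp_all
      · have : w ∉ s := fun h => hw (hs h)
        simp [hw, this]
  constructor
  · intro hd
    have hne : (H.image fun h => Finset.univ.filter fun w => h w = 1).shatterer.Nonempty :=
      ⟨∅, Finset.mem_shatterer.2 ((key ∅).2 fun g =>
        ⟨hH.choose, hH.choose_spec, fun x => absurd x.2 (Finset.notMem_empty _)⟩)⟩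
    obtain ⟨Y, hY, hYc⟩ := Finset.exists_mem_eq_sup _ hne Finset.card
    have hd' : d ≤ Y.card := by
      rw [← hYc]
      unfold functionVCDim Finset.vcDim at hd
      convert hd
    obtain ⟨X, hXY, hXc⟩ := Finset.exists_subset_card_eq hd'
    exact ⟨X, hXc, (key X).1 ((Finset.mem_shatterer.1 hY).mono_right hXY)⟩
  · rintro ⟨X, rfl, hX⟩
    have := ((key X).2 hX).card_le_vcDim
    unfold functionVCDim
    convert this

/-! Write n = |U| and Q = q^t. Each vertex has Q/q neighbours, and two vertices have at most Q/q^2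
common ones, so the number of neighbours in a set Y has variance small enough for Chebyshev
(`sum_sq_le`). Hence at least half of U is regular, of degree about n/q in U, and a complete pair S
× Y satisfies |S||Y|q ≤ 4Q (`card_mul_card_le`).

Dimension 2: by Cauchy–Schwarz, codegrees in U summed over pairs of regular vertices total at least
n^3/(16q^2). A pair with a common neighbour that misses one of the other patterns has one
neighbourhood inside the other, or the complement of one inside the other. Each case produces
complete pairs, so these codegrees total only O(nQ/q), too little once n^2 ≥ 400qQ.

Dimension 3, for t ≥ 3: put P = q^(t-3). If n ≥ 200q^(t-1), averaging gives y ∈ U with a large set D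
of regular neighbours, most pairs in D having more than P common neighbours in U. Since D lies in
the hyperplane of points with dot product 1 with y, three non-collinear points of D are linearly
independent and have exactly P common neighbours in all. So each pair has a common neighbour in U
missed by the third point; y realises the full pattern, and degree counts give the rest. -/

open Classical in
/-- The neighbours of `x` in the finite set `Y`. -/
noncomputable def nbrIn {V : Type*} (Adj : V → V → Prop) (Y : Finset V) (x : V) : Finset V :=
  Y.filter fun y => Adj x y

@[simp] theorem mem_nbrIn {V : Type*} {Adj : V → V → Prop} {Y : Finset V} {x y : V} :
    y ∈ nbrIn Adj Y x ↔ y ∈ Y ∧ Adj x y := by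
  classical
  simp [nbrIn]

theorem nbrIn_subset {V : Type*} {Adj : V → V → Prop} {Y : Finset V} {x : V} :
    nbrIn Adj Y x ⊆ Y := fun _ h => (mem_nbrIn.1 h).1

open Classical in
theorem card_nbrIn {V : Type*} {Adj : V → V → Prop} (Y : Finset V) (x : V) :
    ((nbrIn Adj Y x).card : ℝ) = ∑ y ∈ Y, if Adj x y then 1 else 0 := by
  simp [nbrIn]

/-- A tuple of vertices of `U` all of whose adjacency patterns are realised in `U` witnesses a
lower bound for the VC-dimension. -/
theorem le_functionVCDim_adjFamily {V : Type*} {Adj : V → V → Prop} {U : Finset V} {d : ℕ}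
    (x : Fin d → V) (hx : Function.Injective x) (hU : ∀ i, x i ∈ U)
    (h : ∀ g : Fin d → Prop, ∃ v ∈ U, ∀ i, Adj (x i) v ↔ g i) :
    d ≤ functionVCDim (adjFamily Adj U) := by
  classical
  obtain ⟨v₀, hv₀, -⟩ := h fun _ => True
  refine (le_functionVCDim_iff _ ⟨_, Finset.mem_image_of_mem _ (Finset.mem_univ ⟨v₀, hv₀⟩)⟩ d).2 ?_
  have hinj : Function.Injective fun i => (⟨x i, hU i⟩ : U) := fun i j hij =>
    hx (congrArg Subtype.val hij)
  refine ⟨Finset.univ.image fun i => (⟨x i, hU i⟩ : U), ?_, fun g => ?_⟩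
  · rw [Finset.card_image_of_injective _ hinj, Finset.card_univ, Fintype.card_fin]
  · obtain ⟨v, hv, hvg⟩ := h fun i =>
      g ⟨⟨x i, hU i⟩, Finset.mem_image_of_mem _ (Finset.mem_univ i)⟩ = 1
    refine ⟨_, Finset.mem_image_of_mem _ (Finset.mem_univ ⟨v, hv⟩), ?_⟩
    rintro ⟨w, hw⟩
    obtain ⟨i, -, rfl⟩ := Finset.mem_image.1 hw
    have hi := hvg i
    have two : ∀ a : Fin 2, a ≠ 1 → a = 0 := by decide
    by_cases ha : Adj (x i) v
    · simp [adjFun, ha, hi.1 ha]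
    · simp [adjFun, ha, two _ fun hg => ha (hi.2 hg)]

/-! ### Second moments and regular vertices. -/

/-- A graph on at most `Q` vertices, possibly with loops, in which every degree is `Q / q` and any
two vertices have at most `Q / q ^ 2` common neighbours. -/
structure IsUniformGraph {V : Type*} [Fintype V] (Adj : V → V → Prop) (q Q : ℝ) : Prop where
  symm : ∀ x y, Adj x y → Adj y x
  two_le : 2 ≤ q
  card_le : (Fintype.card V : ℝ) ≤ Q
  deg : ∀ y, q * (nbrIn Adj Finset.univ y).card = Q
  codeg : ∀ y z, y ≠ z → q ^ 2 * (nbrIn Adj (nbrIn Adj Finset.univ y) z).card ≤ Q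

namespace IsUniformGraph

open Classical in
/-- The vertices of `U` whose number of neighbours in `U` is within a factor `1 / 2` of what is
expected. -/
noncomputable def regularPart {V : Type*} (Adj : V → V → Prop) (q : ℝ) (U : Finset V) : Finset V :=
  U.filter fun x => |q * (nbrIn Adj U x).card - U.card| ≤ (U.card : ℝ) / 2

theorem regularPart_subset {V : Type*} {Adj : V → V → Prop} {q : ℝ} {U : Finset V} :
    regularPart Adj q U ⊆ U :=
  Finset.filter_subset _ _

theorem le_of_mem_regularPart {V : Type*} {Adj : V → V → Prop} {q : ℝ} {U : Finset V}
    {x : V} (hx : x ∈ regularPart Adj q U) :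
    (U.card : ℝ) / 2 ≤ q * (nbrIn Adj U x).card := by
  have := (abs_le.1 (Finset.mem_filter.1 hx).2).1
  linarith

theorem le_of_mem_regularPart' {V : Type*} {Adj : V → V → Prop} {q : ℝ} {U : Finset V}
    {x : V} (hx : x ∈ regularPart Adj q U) :
    q * (nbrIn Adj U x).card ≤ 3 * (U.card : ℝ) / 2 := by
  have := (abs_le.1 (Finset.mem_filter.1 hx).2).2
  linarith

variable {V : Type*} [Fintype V] {Adj : V → V → Prop} {q Q : ℝ}

theorem comm (h : IsUniformGraph Adj q Q) (x y : V) : Adj x y ↔ Adj y x :=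
  ⟨h.symm x y, h.symm y x⟩

theorem nonneg (h : IsUniformGraph Adj q Q) : 0 ≤ Q := (Nat.cast_nonneg _).trans h.card_le

theorem sum_sq_le (h : IsUniformGraph Adj q Q) (Y : Finset V) :
    ∑ x, (q * (nbrIn Adj Y x).card - Y.card) ^ 2 ≤ Y.card * (q * Q) := by
  classical
  have hq := h.two_le
  set m : ℝ := (Y.card : ℝ) with hm
  have h1 : ∑ x, q * ((nbrIn Adj Y x).card : ℝ) = m * Q := by
    simp_rw [card_nbrIn]
    rw [← Finset.mul_sum, Finset.sum_comm, Finset.mul_sum]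
    have : ∀ y ∈ Y, q * ∑ x : V, (if Adj x y then (1 : ℝ) else 0) = Q := fun y _ => by
      rw [← h.deg y, card_nbrIn]
      simp_rw [h.comm _ y]
    rw [Finset.sum_congr rfl this]
    simp [hm]
  have h2 : ∑ x, (q * ((nbrIn Adj Y x).card : ℝ)) ^ 2 ≤ m * (q * Q) + m ^ 2 * Q := by
    have e : ∑ x, (q * ((nbrIn Adj Y x).card : ℝ)) ^ 2 =
        ∑ y ∈ Y, ∑ z ∈ Y, q ^ 2 * ((nbrIn Adj (nbrIn Adj Finset.univ y) z).card : ℝ) := by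
      simp_rw [mul_pow, ← Finset.mul_sum]
      congr 1
      simp_rw [card_nbrIn, sq, Finset.sum_mul_sum]
      rw [Finset.sum_comm]
      refine Finset.sum_congr rfl fun y _ => ?_
      rw [Finset.sum_comm]
      refine Finset.sum_congr rfl fun z _ => ?_
      simp only [nbrIn, Finset.sum_filter]
      refine Finset.sum_congr rfl fun x _ => ?_
      rw [h.comm x y, h.comm x z]
      split_ifs <;> simp
    -- Off the diagonal the codegree bound gives Q; on it the degree gives exactly qQ.
    have b : ∀ y ∈ Y, ∀ z ∈ Y,
        q ^ 2 * ((nbrIn Adj (nbrIn Adj Finset.univ y) z).card : ℝ) ≤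
          (if y = z then q * Q else 0) + Q := by
      intro y _ z _
      have hQ := h.nonneg
      split_ifs with hyz
      · subst hyz
        have : ((nbrIn Adj (nbrIn Adj Finset.univ y) y).card : ℝ) ≤
            (nbrIn Adj Finset.univ y).card := by
          exact_mod_cast Finset.card_le_card nbrIn_subset
        have hd := h.deg y
        nlinarith [mul_le_mul_of_nonneg_left this (sq_nonneg q)]
      · simpa using h.codeg y z hyz
    rw [e]
    refine (Finset.sum_le_sum fun y hy => Finset.sum_le_sum fun z hz => b y hy z hz).trans ?_
    simp only [Finset.sum_add_distrib, Finset.sum_ite_eq, Finset.sum_const, nsmul_eq_mul]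
    rw [Finset.sum_congr rfl fun y hy => if_pos hy]
    simp only [Finset.sum_const, nsmul_eq_mul, ← hm]
    exact le_of_eq (by ring)
  have h3 : ∑ x, (q * ((nbrIn Adj Y x).card : ℝ) - m) ^ 2 =
      ∑ x, (q * ((nbrIn Adj Y x).card : ℝ)) ^ 2 - 2 * m * ∑ x, q * ((nbrIn Adj Y x).card : ℝ) +
        Fintype.card V * m ^ 2 := by
    simp_rw [sub_sq]
    rw [Finset.sum_add_distrib, Finset.sum_sub_distrib, Finset.mul_sum]
    simp only [Finset.sum_const, nsmul_eq_mul, Finset.card_univ]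
    congr 2
    exact Finset.sum_congr rfl fun x _ => by ring
  rw [h3, h1]
  nlinarith [mul_le_mul_of_nonneg_right h.card_le (sq_nonneg m)]

/-- Chebyshev's inequality for the number of neighbours in `Y`. -/
theorem card_mul_sq_le (h : IsUniformGraph Adj q Q) (Y S : Finset V) {c : ℝ} (hc : 0 ≤ c)
    (hS : ∀ x ∈ S, c ≤ |q * (nbrIn Adj Y x).card - Y.card|) :
    S.card * c ^ 2 ≤ Y.card * (q * Q) := by
  refine le_trans ?_ (h.sum_sq_le Y)
  rw [← nsmul_eq_mul, ← Finset.sum_const]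
  refine (Finset.sum_le_sum fun x hx => ?_).trans
    (Finset.sum_le_sum_of_subset_of_nonneg (Finset.subset_univ S) fun x _ _ => sq_nonneg _)
  rw [← sq_abs (q * _ - _)]
  exact pow_le_pow_left₀ hc (hS x hx) 2

/-- A vertex of S sees all of Y, so it deviates from the mean by (q - 1)|Y| ≥ q|Y|/2; Chebyshev
leaves room for few such vertices. -/
theorem card_mul_card_le (h : IsUniformGraph Adj q Q) (Y S : Finset V)
    (hS : ∀ x ∈ S, ∀ y ∈ Y, Adj x y) : (S.card : ℝ) * Y.card * q ≤ 4 * Q := by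
  have hq := h.two_le
  rcases Y.eq_empty_or_nonempty with rfl | hY
  · simpa using h.nonneg
  have hm : (0 : ℝ) < Y.card := by exact_mod_cast hY.card_pos
  have key := h.card_mul_sq_le Y S (c := q * Y.card / 2) (by positivity) fun x hx => by
    have : nbrIn Adj Y x = Y := by
      ext y
      simpa using hS x hx y
    rw [this]
    refine le_trans ?_ (le_abs_self _)
    nlinarith
  have hpos : 0 < (Y.card : ℝ) * q := by positivity
  refine le_of_mul_le_mul_right ?_ hpos
  nlinarith

theorem half_le_card_regularPart (h : IsUniformGraph Adj q Q) {U : Finset V}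
    (hU : 8 * (q * Q) ≤ (U.card : ℝ) ^ 2) :
    (U.card : ℝ) / 2 ≤ (regularPart Adj q U).card := by
  classical
  rcases U.eq_empty_or_nonempty with rfl | hne
  · simp
  have hn : (0 : ℝ) < U.card := by exact_mod_cast hne.card_pos
  have key := h.card_mul_sq_le U (U \ regularPart Adj q U) (c := (U.card : ℝ) / 2)
    (by positivity) fun x hx => by
      rw [Finset.mem_sdiff] at hx
      by_contra hlt
      exact hx.2 (Finset.mem_filter.2 ⟨hx.1, (not_le.1 hlt).le⟩)
  rw [Finset.cast_card_sdiff regularPart_subset] at key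
  by_contra! hlt
  nlinarith [mul_pos hn (mul_pos hn (sub_pos.2 hlt))]

theorem sum_card_nbrIn_comm (h : IsUniformGraph Adj q Q) (U X : Finset V) :
    ∑ y ∈ U, ((nbrIn Adj X y).card : ℝ) = ∑ x ∈ X, ((nbrIn Adj U x).card : ℝ) := by
  classical
  simp_rw [card_nbrIn]
  rw [Finset.sum_comm]
  simp_rw [h.comm]

/-- Cauchy–Schwarz on the edges between U and its regular part, of which there are at least
(n/2)(n/(2q)). -/
theorem le_sum_sq_card_nbrIn (h : IsUniformGraph Adj q Q) {U : Finset V}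
    (hU : 8 * (q * Q) ≤ (U.card : ℝ) ^ 2) :
    (U.card : ℝ) ^ 3 ≤
      16 * q ^ 2 * ∑ y ∈ U, ((nbrIn Adj (regularPart Adj q U) y).card : ℝ) ^ 2 := by
  rcases U.eq_empty_or_nonempty with rfl | hne
  · simp
  have hn : (0 : ℝ) < U.card := by exact_mod_cast hne.card_pos
  have hq := h.two_le
  have h1 : (U.card : ℝ) / 2 * (U.card / 2) ≤
      q * ∑ y ∈ U, ((nbrIn Adj (regularPart Adj q U) y).card : ℝ) := by
    rw [h.sum_card_nbrIn_comm, Finset.mul_sum]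
    refine le_trans (mul_le_mul_of_nonneg_right (h.half_le_card_regularPart hU) (by positivity)) ?_
    rw [← nsmul_eq_mul, ← Finset.sum_const]
    exact Finset.sum_le_sum fun x hx => le_of_mem_regularPart hx
  have h2 := sq_sum_le_card_mul_sum_sq (s := U)
    (f := fun y => ((nbrIn Adj (regularPart Adj q U) y).card : ℝ))
  have h3 := pow_le_pow_left₀ (by positivity) h1 2
  refine le_of_mul_le_mul_left ?_ hn
  nlinarith [mul_le_mul_of_nonneg_left h2 (sq_nonneg q)]

-- Counting paths x, y, z by their middle vertex turns sums over neighbourhoods into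
-- codegree-weighted sums over pairs.
open Classical in
theorem sum_pairs_eq (h : IsUniformGraph Adj q Q) (U X : Finset V) (w : V → V → ℝ) :
    ∑ y ∈ U, ∑ x ∈ nbrIn Adj X y, ∑ z ∈ nbrIn Adj X y, w x z =
      ∑ x ∈ X, ∑ z ∈ X, (nbrIn Adj (nbrIn Adj U x) z).card * w x z := by
  simp_rw [card_nbrIn, nbrIn, Finset.sum_filter, Finset.sum_mul]
  rw [Finset.sum_comm]
  refine Finset.sum_congr rfl fun x _ => ?_
  symm
  rw [Finset.sum_comm]
  refine Finset.sum_congr rfl fun y _ => ?_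
  rw [h.comm y x]
  split_ifs
  · exact Finset.sum_congr rfl fun z _ => by rw [h.comm z y]; split_ifs <;> simp
  · simp

theorem sum_sq_card_nbrIn (h : IsUniformGraph Adj q Q) (U X : Finset V) :
    ∑ y ∈ U, ((nbrIn Adj X y).card : ℝ) ^ 2 =
      ∑ x ∈ X, ∑ z ∈ X, ((nbrIn Adj (nbrIn Adj U x) z).card : ℝ) := by
  have := h.sum_pairs_eq U X fun _ _ => 1
  simpa [sq] using this

end IsUniformGraph

/-! ### Two vertices realising all four patterns. -/

namespace IsUniformGraph

variable {V : Type*} [Fintype V] {Adj : V → V → Prop} {q Q : ℝ}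

open Classical in
theorem sum_ite_contains_le (h : IsUniformGraph Adj q Q) (X Y : Finset V) {c k : ℝ}
    (hk : 0 ≤ k) (hc : c ≤ k * Y.card) :
    q * ∑ z ∈ X, (if ∀ y ∈ Y, Adj z y then c else 0) ≤ 4 * k * Q := by
  have hq := h.two_le
  have key := h.card_mul_card_le Y (X.filter fun z => ∀ y ∈ Y, Adj z y)
    fun z hz => (Finset.mem_filter.1 hz).2
  rw [← Finset.sum_filter, Finset.sum_const, nsmul_eq_mul]
  set S : ℝ := ((X.filter fun z => ∀ y ∈ Y, Adj z y).card : ℝ)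
  have hS : 0 ≤ S := Nat.cast_nonneg _
  have h1 : q * (S * c) ≤ q * (S * (k * Y.card)) := by gcongr
  nlinarith [mul_le_mul_of_nonneg_left key hk]

theorem exists_pair (h : IsUniformGraph Adj q Q) {U : Finset V} (hne : U.Nonempty)
    (hU : 400 * (q * Q) ≤ (U.card : ℝ) ^ 2) :
    ∃ x ∈ U, ∃ z ∈ U, (∃ y ∈ U, Adj x y ∧ Adj z y) ∧ (∃ y ∈ U, Adj x y ∧ ¬ Adj z y) ∧
      (∃ y ∈ U, ¬ Adj x y ∧ Adj z y) ∧ ∃ y ∈ U, ¬ Adj x y ∧ ¬ Adj z y := by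
  classical
  by_contra! hcon
  have hq := h.two_le
  have hn : (0 : ℝ) < U.card := by exact_mod_cast hne.card_pos
  have hQ : 0 < Q := by
    have : (U.card : ℝ) ≤ Fintype.card V := by exact_mod_cast U.card_le_univ
    linarith [h.card_le]
  set X := regularPart Adj q U with hX
  have hXU : (X.card : ℝ) ≤ U.card := by exact_mod_cast Finset.card_le_card regularPart_subset
  have hlow := h.le_sum_sq_card_nbrIn (U := U) (by nlinarith [mul_pos (by linarith : 0 < q) hQ])
  rw [h.sum_sq_card_nbrIn, ← hX] at hlow
  let N := fun x => nbrIn Adj U x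
  let w := fun x z => if ∀ y ∈ N x, Adj z y then ((N x).card : ℝ) else 0
  let w' := fun x z => if ∀ y ∈ U \ N x, Adj z y then ((N x).card : ℝ) else 0
  have hw0 : ∀ x z, 0 ≤ w x z := fun x z => by dsimp only [w]; split_ifs <;> positivity
  have hw0' : ∀ x z, 0 ≤ w' x z := fun x z => by dsimp only [w']; split_ifs <;> positivity
  -- A positive codegree realises the pattern (1,1), so by assumption another one fails; each of the
  -- three weights pays for one of these failures.
  have bound : ∀ x ∈ X, ∀ z ∈ X,
      ((nbrIn Adj (nbrIn Adj U x) z).card : ℝ) ≤ w x z + w z x + w' x z := by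
    intro x hx z hz
    have hle1 : ((nbrIn Adj (nbrIn Adj U x) z).card : ℝ) ≤ (N x).card := by
      exact_mod_cast Finset.card_le_card nbrIn_subset
    have hle2 : ((nbrIn Adj (nbrIn Adj U x) z).card : ℝ) ≤ (N z).card := by
      exact_mod_cast Finset.card_le_card fun y hy => by
        simp only [mem_nbrIn, N] at hy ⊢
        exact ⟨hy.1.1, hy.2⟩
    rcases (nbrIn Adj (nbrIn Adj U x) z).eq_empty_or_nonempty with he | ⟨y, hy⟩
    · rw [he]
      simpa using add_nonneg (add_nonneg (hw0 x z) (hw0 z x)) (hw0' x z)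
    · simp only [mem_nbrIn] at hy
      by_cases h1 : ∀ y ∈ N x, Adj z y
      · have : w x z = (N x).card := if_pos h1
        linarith [hw0 z x, hw0' x z]
      by_cases h2 : ∀ y ∈ N z, Adj x y
      · have : w z x = (N z).card := if_pos h2
        linarith [hw0 x z, hw0' x z]
      · have h3 : ∀ y ∈ U \ N x, Adj z y := by
          push Not at h1 h2
          obtain ⟨a, ha, ha'⟩ := h1
          obtain ⟨b, hb, hb'⟩ := h2
          simp only [mem_nbrIn, N] at ha hb
          intro c hc
          simp only [Finset.mem_sdiff, mem_nbrIn, N, not_and] at hc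
          exact hcon x (regularPart_subset hx) z (regularPart_subset hz) ⟨y, hy.1.1, hy.1.2, hy.2⟩
            ⟨a, ha.1, ha.2, ha'⟩ ⟨b, hb.1, hb', hb.2⟩ c hc.1 (hc.2 hc.1)
        have : w' x z = (N x).card := if_pos h3
        linarith [hw0 z x, hw0 x z]
  have b1 : ∀ x, q * ∑ z ∈ X, w x z ≤ 4 * 1 * Q := fun x =>
    h.sum_ite_contains_le X (N x) zero_le_one (by simp)
  -- Regularity and q ≥ 2 give |N x| ≤ 3n/4, so |N x| is at most 3 times the size of its complement
  -- in U.
  have b3 : ∀ x ∈ X, q * ∑ z ∈ X, w' x z ≤ 4 * 3 * Q := fun x hx =>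
    h.sum_ite_contains_le X (U \ N x) (by norm_num) (by
      have h1 := le_of_mem_regularPart' hx
      have h0 : (0 : ℝ) ≤ (N x).card := Nat.cast_nonneg _
      rw [Finset.cast_card_sdiff nbrIn_subset]
      nlinarith [mul_le_mul_of_nonneg_right hq h0])
  have total : q * ∑ x ∈ X, ∑ z ∈ X, ((nbrIn Adj (nbrIn Adj U x) z).card : ℝ) ≤
      X.card * (20 * Q) := by
    have e1 := Finset.sum_le_sum fun x (hx : x ∈ X) =>
      Finset.sum_le_sum fun z (hz : z ∈ X) => bound x hx z hz
    simp only [Finset.sum_add_distrib] at e1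
    rw [Finset.sum_comm (f := fun x z => w z x)] at e1
    have e2 := Finset.sum_le_sum fun x (_ : x ∈ X) => b1 x
    have e3 := Finset.sum_le_sum b3
    simp only [← Finset.mul_sum, Finset.sum_const, nsmul_eq_mul] at e2 e3
    nlinarith
  have hf : (U.card : ℝ) ^ 3 ≤ U.card * (320 * (q * Q)) := by
    refine hlow.trans ?_
    nlinarith [mul_le_mul_of_nonneg_left (total.trans (mul_le_mul_of_nonneg_right hXU
      (by positivity))) (by linarith : 0 ≤ q)]
  have : (U.card : ℝ) ^ 2 ≤ 320 * (q * Q) := le_of_mul_le_mul_left (by nlinarith) hn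
  nlinarith [mul_pos (by linarith : 0 < q) hQ]

theorem two_le_functionVCDim (h : IsUniformGraph Adj q Q) {U : Finset V} (hne : U.Nonempty)
    (hU : 400 * (q * Q) ≤ (U.card : ℝ) ^ 2) : 2 ≤ functionVCDim (adjFamily Adj U) := by
  obtain ⟨x, hx, z, hz, ⟨a, ha, hax, haz⟩, ⟨b, hb, hbx, hbz⟩, ⟨c, hc, hcx, hcz⟩, d, hd, hdx, hdz⟩ :=
    h.exists_pair hne hU
  have hxz : x ≠ z := fun e => hbz (e ▸ hbx)
  refine le_functionVCDim_adjFamily ![x, z] (fun i j => ?_) (fun i => ?_) fun g => ?_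
  · fin_cases i <;> fin_cases j <;> simp [hxz, hxz.symm]
  · fin_cases i <;> simp [hx, hz]
  · by_cases h0 : g 0 <;> by_cases h1 : g 1
    · exact ⟨a, ha, by simp [Fin.forall_fin_two, *]⟩
    · exact ⟨b, hb, by simp [Fin.forall_fin_two, *]⟩
    · exact ⟨c, hc, by simp [Fin.forall_fin_two, *]⟩
    · exact ⟨d, hd, by simp [Fin.forall_fin_two, *]⟩

/-! ### Three vertices realising all eight patterns. -/

open Classical in
/-- Some neighbourhood is large, and most pairs in it have more than `P` common neighbours. -/
theorem exists_rich_nbrIn (h : IsUniformGraph Adj q Q) {U : Finset V} (hne : U.Nonempty) {P : ℝ}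
    (hP : 0 ≤ P) (hU : 8 * (q * Q) ≤ (U.card : ℝ) ^ 2) (hUP : 200 * q ^ 2 * P ≤ U.card) :
    ∃ y ∈ U, (U.card : ℝ) ≤ 8 * q * (nbrIn Adj (regularPart Adj q U) y).card ∧
      8 * ∑ x ∈ nbrIn Adj (regularPart Adj q U) y, ∑ z ∈ nbrIn Adj (regularPart Adj q U) y,
        (if ((nbrIn Adj (nbrIn Adj U x) z).card : ℝ) ≤ P then (1 : ℝ) else 0) ≤
        ((nbrIn Adj (regularPart Adj q U) y).card : ℝ) ^ 2 := by
  have hq := h.two_le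
  have hn : (0 : ℝ) < U.card := by exact_mod_cast hne.card_pos
  set X := regularPart Adj q U with hX
  have hXU : (X.card : ℝ) ≤ U.card := by exact_mod_cast Finset.card_le_card regularPart_subset
  have hlow := h.le_sum_sq_card_nbrIn hU
  rw [← hX] at hlow
  set w : V → V → ℝ := fun x z =>
    if ((nbrIn Adj (nbrIn Adj U x) z).card : ℝ) ≤ P then (1 : ℝ) else 0 with hw
  have hbad : ∑ y ∈ U, ∑ x ∈ nbrIn Adj X y, ∑ z ∈ nbrIn Adj X y, w x z ≤
      (U.card : ℝ) ^ 2 * P := by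
    rw [h.sum_pairs_eq]
    have : ∀ x ∈ X, ∀ z ∈ X, ((nbrIn Adj (nbrIn Adj U x) z).card : ℝ) * w x z ≤ P := by
      intro x _ z _
      dsimp only [w]
      split_ifs with hc <;> simpa
    refine (Finset.sum_le_sum fun x hx => Finset.sum_le_sum (this x hx)).trans ?_
    simp only [Finset.sum_const, nsmul_eq_mul]
    rw [← mul_assoc, ← sq]
    gcongr
  -- Averaging |D|^2 minus 8 times the number of bad pairs yields one y with both properties; the
  -- constants work because 1/16 - 8/200 ≥ 1/64.
  have hsum : ∑ y ∈ U, (U.card : ℝ) ^ 2 / (64 * q ^ 2) ≤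
      ∑ y ∈ U, (((nbrIn Adj X y).card : ℝ) ^ 2 -
        8 * ∑ x ∈ nbrIn Adj X y, ∑ z ∈ nbrIn Adj X y, w x z) := by
    rw [Finset.sum_sub_distrib, ← Finset.mul_sum, Finset.sum_const, nsmul_eq_mul, ← mul_div_assoc,
      div_le_iff₀ (by positivity)]
    have h1 := mul_le_mul_of_nonneg_left hbad (by positivity : (0 : ℝ) ≤ q ^ 2)
    have h2 := mul_le_mul_of_nonneg_left hUP (by positivity : 0 ≤ (U.card : ℝ) ^ 2)
    have h3 : 0 ≤ (U.card : ℝ) ^ 3 := by positivity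
    nlinarith
  obtain ⟨y, hy, hle⟩ := Finset.exists_le_of_sum_le hne hsum
  have hpos : 0 ≤ ∑ x ∈ nbrIn Adj X y, ∑ z ∈ nbrIn Adj X y, w x z :=
    Finset.sum_nonneg fun x _ => Finset.sum_nonneg fun z _ => by
      dsimp only [w]; split_ifs <;> norm_num
  have hpos' : 0 ≤ (U.card : ℝ) ^ 2 / (64 * q ^ 2) := by positivity
  refine ⟨y, hy, ?_, by linarith⟩
  have h1 : (U.card : ℝ) ^ 2 / (64 * q ^ 2) ≤ ((nbrIn Adj X y).card : ℝ) ^ 2 := by linarith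
  rw [div_le_iff₀ (by positivity)] at h1
  refine le_of_sq_le_sq ?_ (by positivity)
  nlinarith

end IsUniformGraph

-- A union bound over ordered triples: the three bad pairs cost at most 3/8 of them, coincidences x
-- = y and the relation T at most 1/16 each.
open Classical in
theorem exists_triple {V : Type*} (D : Finset V) (B : V → V → Prop) (T : V → V → V → Prop) {q : ℝ}
    (hq : 1 ≤ q) (hD : 16 * q ≤ D.card)
    (hB : 8 * ∑ x ∈ D, ∑ z ∈ D, (if B x z then (1 : ℝ) else 0) ≤ (D.card : ℝ) ^ 2)
    (hT : ∀ x ∈ D, ∀ y ∈ D, ((D.filter (T x y)).card : ℝ) ≤ q) :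
    ∃ x ∈ D, ∃ y ∈ D, ∃ z ∈ D, ¬ B x y ∧ ¬ B x z ∧ ¬ B y z ∧ x ≠ y ∧ ¬ T x y z := by
  by_contra! hcon
  let b := fun x z => if B x z then (1 : ℝ) else 0
  have b0 : ∀ x z, 0 ≤ b x z := fun x z => by dsimp only [b]; split_ifs <;> norm_num
  have key : ∀ x ∈ D, ∀ y ∈ D, ∀ z ∈ D, (1 : ℝ) ≤
      b x y + b x z + b y z + (if x = y then 1 else 0) + (if T x y z then 1 else 0) := by
    intro x hx y hy z hz
    have e0 : (0 : ℝ) ≤ if x = y then 1 else 0 := by split_ifs <;> norm_num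
    have t0 : (0 : ℝ) ≤ if T x y z then 1 else 0 := by split_ifs <;> norm_num
    have := b0 x y; have := b0 x z; have := b0 y z
    by_cases h1 : B x y
    · have : b x y = 1 := if_pos h1
      linarith
    by_cases h2 : B x z
    · have : b x z = 1 := if_pos h2
      linarith
    by_cases h3 : B y z
    · have : b y z = 1 := if_pos h3
      linarith
    by_cases h4 : x = y
    · rw [if_pos h4] at e0 ⊢
      linarith
    · rw [if_pos (hcon x hx y hy z hz h1 h2 h3 h4)]
      linarith
  have hT' : ∑ x ∈ D, ∑ y ∈ D, ∑ z ∈ D, (if T x y z then (1 : ℝ) else 0) ≤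
      D.card * (D.card * q) := by
    simp only [← nsmul_eq_mul (D.card)]
    rw [← Finset.sum_const, ← Finset.sum_const]
    refine Finset.sum_le_sum fun x hx => Finset.sum_le_sum fun y hy => ?_
    simpa using hT x hx y hy
  have hs := Finset.sum_le_sum fun x hx => Finset.sum_le_sum fun y hy =>
    Finset.sum_le_sum fun z hz => key x hx y hy z hz
  simp only [Finset.sum_add_distrib, Finset.sum_const, nsmul_eq_mul, ← Finset.mul_sum,
    Finset.sum_ite_eq] at hs
  rw [Finset.sum_congr rfl fun x hx => if_pos hx] at hs
  simp only [Finset.sum_const, nsmul_eq_mul] at hs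
  change 8 * ∑ x ∈ D, ∑ z ∈ D, b x z ≤ _ at hB
  have hd : 0 < (D.card : ℝ) := by linarith
  have h1 := mul_le_mul_of_nonneg_left hB hd.le
  have h2 := mul_le_mul_of_nonneg_left hD (by positivity : 0 ≤ (D.card : ℝ) ^ 2)
  nlinarith [mul_pos hd (mul_pos hd hd), mul_le_mul_of_nonneg_left hq (mul_pos hd hd).le]

/-- Two ones: the codegree in U exceeds P, the bound on triple common neighbours. One one: a degree
in U exceeds 2qP, the most that two codegrees can cover. No ones: three neighbourhoods cover only
3q^2P < n vertices. -/
theorem IsUniformGraph.three_le_functionVCDim {V : Type*} [Fintype V] {Adj : V → V → Prop}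
    {q Q P : ℝ} (h : IsUniformGraph Adj q Q) {U : Finset V} {x : Fin 3 → V}
    (hx : Function.Injective x) (hxU : ∀ i, x i ∈ U) (hQ : Q = q ^ 3 * P)
    (hU : 4 * q ^ 2 * P < U.card)
    (hdeg : ∀ i, (U.card : ℝ) / 2 ≤ q * (nbrIn Adj U (x i)).card)
    (hcodeg : ∀ i j, i ≠ j → P < (nbrIn Adj (nbrIn Adj U (x i)) (x j)).card)
    (hcommon : ∀ S : Finset V, (∀ v ∈ S, ∀ i, Adj (x i) v) → (S.card : ℝ) ≤ P)
    (hall : ∃ v ∈ U, ∀ i, Adj (x i) v) : 3 ≤ functionVCDim (adjFamily Adj U) := by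
  classical
  have hq := h.two_le
  have hq0 : 0 < q := by linarith
  have cases3 : ∀ i j k l : Fin 3, i ≠ j → i ≠ k → j ≠ k → l = i ∨ l = j ∨ l = k := by decide
  have two : ∀ i j k, i ≠ j → i ≠ k → j ≠ k →
      ∃ v ∈ U, Adj (x i) v ∧ Adj (x j) v ∧ ¬ Adj (x k) v := by
    intro i j k hij hik hjk
    by_contra! hcon
    refine (hcodeg i j hij).not_ge (hcommon _ fun v hv l => ?_)
    simp only [mem_nbrIn] at hv
    rcases cases3 i j k l hij hik hjk with rfl | rfl | rfl
    exacts [hv.1.2, hv.2, hcon v hv.1.1 hv.1.2 hv.2]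
  have one : ∀ i j k, i ≠ j → i ≠ k →
      ∃ v ∈ U, Adj (x i) v ∧ ¬ Adj (x j) v ∧ ¬ Adj (x k) v := by
    intro i j k hij hik
    by_contra! hcon
    have hsub : nbrIn Adj U (x i) ⊆ nbrIn Adj (nbrIn Adj Finset.univ (x i)) (x j) ∪
        nbrIn Adj (nbrIn Adj Finset.univ (x i)) (x k) := by
      intro v hv
      have := hcon v
      simp only [mem_nbrIn, Finset.mem_union, Finset.mem_univ, true_and] at hv ⊢
      tauto
    have hc : ((nbrIn Adj U (x i)).card : ℝ) ≤
        (nbrIn Adj (nbrIn Adj Finset.univ (x i)) (x j)).card +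
        (nbrIn Adj (nbrIn Adj Finset.univ (x i)) (x k)).card := by
      exact_mod_cast (Finset.card_le_card hsub).trans (Finset.card_union_le _ _)
    have h1 := h.codeg _ _ (hx.ne hij)
    have h2 := h.codeg _ _ (hx.ne hik)
    have h3 := hdeg i
    have h4 := mul_le_mul_of_nonneg_left hc (sq_nonneg q)
    have h5 : q * (4 * q ^ 2 * P) < q * U.card := mul_lt_mul_of_pos_left hU hq0
    nlinarith [mul_le_mul_of_nonneg_left h3 hq0.le]
  have zero : ∃ v ∈ U, ∀ i, ¬ Adj (x i) v := by
    by_contra! hcon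
    have hsub : U ⊆ Finset.univ.biUnion fun i => nbrIn Adj Finset.univ (x i) := by
      intro v hv
      simpa using hcon v hv
    have hc : (U.card : ℝ) ≤ ∑ i, ((nbrIn Adj Finset.univ (x i)).card : ℝ) := by
      exact_mod_cast (Finset.card_le_card hsub).trans Finset.card_biUnion_le
    have h1 := mul_le_mul_of_nonneg_left hc hq0.le
    rw [Finset.mul_sum] at h1
    simp only [h.deg, Finset.sum_const, Finset.card_univ, Fintype.card_fin, nsmul_eq_mul] at h1
    have h5 : q * (4 * q ^ 2 * P) < q * U.card := mul_lt_mul_of_pos_left hU hq0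
    have := h.nonneg
    push_cast at h1
    nlinarith
  refine le_functionVCDim_adjFamily x hx hxU fun g => ?_
  obtain ⟨a, ha, ha'⟩ := hall
  obtain ⟨z, hz, hz'⟩ := zero
  obtain ⟨v0, hv0, h00, h01, h02⟩ := one 0 1 2 (by decide) (by decide)
  obtain ⟨v1, hv1, h11, h10, h12⟩ := one 1 0 2 (by decide) (by decide)
  obtain ⟨v2, hv2, h22, h20, h21⟩ := one 2 0 1 (by decide) (by decide)
  obtain ⟨w0, hw0, k01, k02, k00⟩ := two 1 2 0 (by decide) (by decide) (by decide)
  obtain ⟨w1, hw1, k10, k12, k11⟩ := two 0 2 1 (by decide) (by decide) (by decide)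
  obtain ⟨w2, hw2, k20, k21, k22⟩ := two 0 1 2 (by decide) (by decide) (by decide)
  by_cases g0 : g 0 <;> by_cases g1 : g 1 <;> by_cases g2 : g 2
  · exact ⟨a, ha, by simp [Fin.forall_fin_succ, *]⟩
  · exact ⟨w2, hw2, by simp [Fin.forall_fin_succ, *]⟩
  · exact ⟨w1, hw1, by simp [Fin.forall_fin_succ, *]⟩
  · exact ⟨v0, hv0, by simp [Fin.forall_fin_succ, *]⟩
  · exact ⟨w0, hw0, by simp [Fin.forall_fin_succ, *]⟩
  · exact ⟨v1, hv1, by simp [Fin.forall_fin_succ, *]⟩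
  · exact ⟨v2, hv2, by simp [Fin.forall_fin_succ, *]⟩
  · exact ⟨z, hz, by simp [Fin.forall_fin_succ, *]⟩

/-! ### Linear algebra of the dot-product graph. -/

section DotProduct

variable {F : Type*} [Field F] {t : ℕ}

theorem dotAdj_symm {x y : DotVertex F t} (h : DotAdj x y) : DotAdj y x := by
  unfold DotAdj at *
  simpa only [mul_comm] using h

theorem linearIndependent_pair_of_dotAdj {x z y : DotVertex F t} (hxz : x ≠ z) (hx : DotAdj x y)
    (hz : DotAdj z y) : LinearIndependent F ![x.1, z.1] := by
  rw [LinearIndependent.pair_iff' x.2]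
  intro a ha
  have : a = 1 := by
    have h1 : ∑ i, (a • x.1) i * y.1 i = a := by
      simp only [Pi.smul_apply, smul_eq_mul, mul_assoc, ← Finset.mul_sum]
      rw [show ∑ i, x.1 i * y.1 i = 1 from hx, mul_one]
    rw [← h1, ha]
    exact hz
  rw [this, one_smul] at ha
  exact hxz (Subtype.ext ha)

/-- Pairing a relation w = ax + bz with y gives a + b = 1, which would put w on the line through x
and z. -/
theorem linearIndependent_triple_of_dotAdj {x z w y : DotVertex F t} (hxz : x ≠ z)
    (hw : ¬ ∃ s : F, x.1 + s • (z.1 - x.1) = w.1) (hx : DotAdj x y) (hz : DotAdj z y)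
    (hwy : DotAdj w y) : LinearIndependent F ![w.1, x.1, z.1] := by
  refine linearIndependent_finCons.2 ⟨linearIndependent_pair_of_dotAdj hxz hx hz, fun hmem => hw ?_⟩
  simp only [Matrix.range_cons, Matrix.range_empty, Set.union_empty, Set.singleton_union] at hmem
  obtain ⟨a, b, hab⟩ := Submodule.mem_span_pair.1 hmem
  have h1 : a + b = 1 := by
    have : ∑ i, (a • x.1 + b • z.1) i * y.1 i = a + b := by
      simp only [Pi.add_apply, Pi.smul_apply, smul_eq_mul, add_mul, mul_assoc,
        Finset.sum_add_distrib, ← Finset.mul_sum]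
      rw [show ∑ i, x.1 i * y.1 i = 1 from hx, show ∑ i, z.1 i * y.1 i = 1 from hz, mul_one,
        mul_one]
    rw [← this, hab]
    exact hwy
  refine ⟨b, ?_⟩
  rw [← hab, eq_sub_of_add_eq h1]
  module

variable [Fintype F]

-- Independent rows define a surjective linear map, all of whose fibres have the same size.
open Classical in
theorem card_dotProduct_eq_mul {k : ℕ} {v : Fin k → Fin t → F} (hv : LinearIndependent F v)
    (c : Fin k → F) :
    (Finset.univ.filter fun y : Fin t → F => ∀ i, ∑ j, v i j * y j = c i).card *
      Fintype.card F ^ k = Fintype.card F ^ t := by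
  let f : (Fin t → F) →ₗ[F] (Fin k → F) := (Matrix.of v).mulVecLin
  have hf : Function.Surjective f := by
    rw [← LinearMap.range_eq_top]
    apply Submodule.eq_top_of_finrank_eq
    have : (Matrix.of v).rank = Fintype.card (Fin k) := LinearIndependent.rank_matrix hv
    simpa [Matrix.rank] using this
  have hfib : ∀ b, (Finset.univ.filter fun y => f y = b).card =
      (Finset.univ.filter fun y => f y = c).card := fun b =>
    AddMonoidHom.card_fiber_eq_of_mem_range f (hf b) (hf c)
  have hsum := Finset.card_eq_sum_card_fiberwise (f := f) (s := Finset.univ) (t := Finset.univ)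
    fun _ _ => Finset.mem_coe.2 (Finset.mem_univ _)
  rw [Finset.sum_congr rfl fun b _ => hfib b] at hsum
  simp only [Finset.card_univ, Fintype.card_fun, Fintype.card_fin, Finset.sum_const,
    smul_eq_mul] at hsum
  rw [hsum, mul_comm]
  congr 2
  ext y
  simp only [Finset.mem_filter, Finset.mem_univ, true_and, funext_iff]
  rfl

open Classical in
theorem card_common_dotAdj_mul {k : ℕ} [NeZero k] {x : Fin k → DotVertex F t}
    (hx : LinearIndependent F fun i => (x i).1) :
    (Finset.univ.filter fun y => ∀ i, DotAdj (x i) y).card * Fintype.card F ^ k =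
      Fintype.card F ^ t := by
  rw [← card_dotProduct_eq_mul hx fun _ => 1, ← Finset.card_map (Function.Embedding.subtype _)]
  congr 2
  ext y
  simp only [Finset.mem_map, Finset.mem_filter, Finset.mem_univ, true_and]
  constructor
  · rintro ⟨y, hy, rfl⟩
    exact hy
  · intro hy
    refine ⟨⟨y, ?_⟩, hy, rfl⟩
    rintro rfl
    simpa using hy 0

open Classical in
theorem isUniformGraph_dotAdj (F : Type*) [Field F] [Fintype F] (t : ℕ) :
    IsUniformGraph (DotAdj (F := F) (t := t)) (Fintype.card F) ((Fintype.card F : ℝ) ^ t) where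
  symm _ _ := dotAdj_symm
  two_le := by exact_mod_cast Fintype.one_lt_card (α := F)
  card_le := by
    have := Fintype.card_subtype_le fun x : Fin t → F => x ≠ 0
    rw [Fintype.card_fun, Fintype.card_fin] at this
    exact_mod_cast this
  deg y := by
    have := card_common_dotAdj_mul (x := ![y])
      (by simpa [linearIndependent_unique_iff] using y.2)
    rw [mul_comm]
    rw [pow_one] at this
    norm_cast
    rw [← this]
    congr 2
    ext z
    simp
  codeg y z hyz := by
    rcases (nbrIn DotAdj (nbrIn DotAdj Finset.univ y) z).eq_empty_or_nonempty with he | ⟨v, hv⟩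
    · rw [he]
      simp
    · simp only [mem_nbrIn, Finset.mem_univ, true_and] at hv
      have := card_common_dotAdj_mul (x := ![y, z]) (by
        convert linearIndependent_pair_of_dotAdj hyz hv.1 hv.2 using 1
        ext i
        fin_cases i <;> rfl)
      rw [mul_comm]
      norm_cast
      rw [← this]
      refine le_of_eq ?_
      congr 2
      ext v
      simp [Fin.forall_fin_two]

open Classical in
theorem three_le_functionVCDim_dotAdj {s : ℕ} {U : Finset (DotVertex F (s + 3))}
    (hU : 200 * (Fintype.card F : ℝ) ^ (s + 2) ≤ U.card) :
    3 ≤ functionVCDim (adjFamily DotAdj U) := by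
  have h := isUniformGraph_dotAdj F (s + 3)
  set q : ℝ := (Fintype.card F : ℝ) with hqdef
  have hq : 2 ≤ q := h.two_le
  set P : ℝ := q ^ s with hP
  have hP1 : 1 ≤ P := one_le_pow₀ (by linarith)
  rw [pow_add, ← hP] at hU
  have hpos : 0 < q ^ 2 * P := by positivity
  have hne : U.Nonempty := by
    rw [← Finset.card_pos, ← Nat.cast_pos (α := ℝ)]
    linarith
  have hU' : 8 * (q * q ^ (s + 3)) ≤ (U.card : ℝ) ^ 2 := by
    have h1 := pow_le_pow_left₀ (by positivity) hU 2
    have h2 : q ^ 4 * P ≤ q ^ 4 * P ^ 2 := by gcongr; nlinarith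
    have h3 : 0 < q ^ 4 * P := by positivity
    rw [pow_add, ← hP]
    nlinarith
  obtain ⟨y, hy, hD, hbad⟩ := h.exists_rich_nbrIn hne (P := P) (by positivity) hU' (by linarith)
  set D := nbrIn DotAdj (IsUniformGraph.regularPart DotAdj q U) y with hDdef
  have hD16 : 16 * q ≤ D.card := by
    have : q * (16 * q) ≤ q * D.card := by nlinarith [mul_le_mul_of_nonneg_left hP1 (sq_nonneg q)]
    exact le_of_mul_le_mul_left this (by linarith)
  have hDU : ∀ x ∈ D, x ∈ U := fun x hx => IsUniformGraph.regularPart_subset (nbrIn_subset hx)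
  -- The common neighbour y turns non-collinearity into linear independence, and later realises the
  -- full pattern.
  have hDy : ∀ x ∈ D, DotAdj x y := fun x hx => dotAdj_symm (mem_nbrIn.1 hx).2
  obtain ⟨x, hx, z, hz, w, hw, hxz, hxw, hzw, hne', hT⟩ := exists_triple D
    (fun x z => ((nbrIn DotAdj (nbrIn DotAdj U x) z).card : ℝ) ≤ P)
    (fun x z w => ∃ s : F, x.1 + s • (z.1 - x.1) = w.1) (q := q) (by linarith) hD16 hbad
    fun x _ z _ => by
      rw [hqdef, ← Finset.card_univ, Nat.cast_le,
        ← Finset.card_image_of_injective _ Subtype.val_injective]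
      refine le_trans (Finset.card_le_card fun w hw => ?_)
        (Finset.card_image_le (s := Finset.univ) (f := fun s : F => x.1 + s • (z.1 - x.1)))
      simp only [Finset.mem_image, Finset.mem_filter, Finset.mem_univ, true_and] at hw ⊢
      obtain ⟨w, ⟨-, hs⟩, rfl⟩ := hw
      exact hs
  have hwx : w ≠ x := fun e => hT ⟨0, by simp [e]⟩
  have hwz : w ≠ z := fun e => hT ⟨1, by simp [e]⟩
  have hind := linearIndependent_triple_of_dotAdj hne' hT (hDy x hx) (hDy z hz) (hDy w hw)
  have hcodeg : ∀ a b : DotVertex F (s + 3), ((nbrIn DotAdj (nbrIn DotAdj U a) b).card : ℝ) =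
      (nbrIn DotAdj (nbrIn DotAdj U b) a).card := fun a b => by
    congr 2
    ext v
    simp only [mem_nbrIn]
    tauto
  push Not at hxz hxw hzw
  refine h.three_le_functionVCDim (P := P) (x := ![w, x, z]) (fun i j => ?_) (fun i => ?_)
    (by rw [pow_add, ← hP, mul_comm]) (by linarith) (fun i => ?_) (fun i j => ?_)
    (fun S hS => ?_) ⟨y, hy, fun i => ?_⟩
  · fin_cases i <;> fin_cases j <;> simp [hne', hwx, hwz, hne'.symm, hwx.symm, hwz.symm]
  · fin_cases i <;> simp [hDU, hx, hz, hw]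
  · apply IsUniformGraph.le_of_mem_regularPart
    apply nbrIn_subset (Adj := DotAdj) (x := y)
    fin_cases i
    exacts [hw, hx, hz]
  · fin_cases i <;> fin_cases j <;>
      simp [hxz, hxw, hzw, hcodeg w x, hcodeg w z, hcodeg z x]
  · have hc := card_common_dotAdj_mul (x := ![w, x, z]) (by
      convert hind using 1
      ext i
      fin_cases i <;> rfl)
    have hle : S.card ≤ Fintype.card F ^ s := by
      refine (Finset.card_le_card fun v hv => ?_).trans (Nat.eq_of_mul_eq_mul_right
        (pow_pos Fintype.card_pos 3) (hc.trans (pow_add _ _ _))).le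
      exact Finset.mem_filter.2 ⟨Finset.mem_univ v, hS v hv⟩
    rw [hP, hqdef]
    exact_mod_cast hle
  · fin_cases i
    exacts [hDy w hw, hDy x hx, hDy z hz]

end DotProduct

/-! ### Comparison of exponents. -/

theorem mainTheorem4 :
    ∃ C : ℝ, 0 < C ∧
      ∀ (F : Type*) [Field F] [Fintype F] (t : ℕ) (U : Finset (DotVertex F t)),
        (C * (Fintype.card F : ℝ) ^ (((t : ℝ) + 1) / 2) ≤ (U.card : ℝ) →
          2 ≤ functionVCDim (adjFamily DotAdj U)) ∧
        (C * max ((Fintype.card F : ℝ) ^ ((7 * (t : ℝ) + 19) / 14))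
              ((Fintype.card F : ℝ) ^ ((t : ℝ) - 1)) ≤ (U.card : ℝ) →
          3 ≤ functionVCDim (adjFamily DotAdj U)) := by
  refine ⟨200, by norm_num, fun F _ _ t U => ?_⟩
  classical
  have h := isUniformGraph_dotAdj F t
  set q : ℝ := (Fintype.card F : ℝ) with hqdef
  have hq : 2 ≤ q := h.two_le
  have hq0 : 0 < q := by linarith
  have hUq : (U.card : ℝ) ≤ q ^ t := by
    have : (U.card : ℝ) ≤ Fintype.card (DotVertex F t) := by exact_mod_cast U.card_le_univ
    exact this.trans h.card_le
  refine ⟨fun hU => ?_, fun hU => ?_⟩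
  · have hpos : 0 < q ^ (((t : ℝ) + 1) / 2) := Real.rpow_pos_of_pos hq0 _
    have hne : U.Nonempty := by
      rw [← Finset.card_pos, ← Nat.cast_pos (α := ℝ)]
      linarith
    refine h.two_le_functionVCDim hne ?_
    have hsq : (q ^ (((t : ℝ) + 1) / 2)) ^ 2 = q * q ^ t := by
      rw [← Real.rpow_natCast, ← Real.rpow_mul hq0.le, ← pow_succ', ← Real.rpow_natCast]
      congr 1
      push_cast
      ring
    rw [← hsq]
    nlinarith
  · rcases lt_or_ge t 3 with ht | ht
    -- For t ≤ 2 the exponent (7t + 19)/14 exceeds t, so U would have more than q^t elements.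
    · exfalso
      have hle : q ^ t ≤ q ^ ((7 * (t : ℝ) + 19) / 14) := by
        rw [← Real.rpow_natCast]
        refine Real.rpow_le_rpow_of_exponent_le (by linarith) ?_
        have : (t : ℝ) ≤ 2 := by exact_mod_cast Nat.le_of_lt_succ ht
        linarith
      have := hle.trans (le_max_left _ (q ^ ((t : ℝ) - 1)))
      have := pow_pos hq0 t
      linarith
    · obtain ⟨s, rfl⟩ := Nat.exists_eq_add_of_le' ht
      refine three_le_functionVCDim_dotAdj (le_trans ?_ hU)
      refine mul_le_mul_of_nonneg_left (le_trans (le_of_eq ?_) (le_max_right _ _)) (by norm_num)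
      rw [← Real.rpow_natCast]
      congr 1
      push_cast
      ring
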